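/- Let $b\ge 2$ be an integer and $\omega_b=e^{2\pi i/b}$. Write an integer $k\ge 0$ in base $b$ as $k=\kappa_1b^{a_1-1}+\cdots+\kappa_vb^{a_v-1}$ with $0<\kappa_i<b$ and $a_1>\cdots>a_v>0$ ($v=0$ if $k=0$). For $x\in[0,1)$ with base $b$ digits $x=\sum_{i\ge1}x_ib^{-i}$ (infinitely many $x_i\ne b-1$) let $\mathrm{wal}_k(x)=\omega_b^{\kappa_1x_{a_1}+\cdots+\kappa_vx_{a_v}}$ be the $k$th Walsh function ($\mathrm{wal}_0=1$), and for $f:[0,1]\to\mathbb R$ let $\hat f(k)=\int_0^1f(x)\overline{\mathrm{wal}_k(x)}\,dx$. For $r\ge1$ put $\mu_r(0)=\mu_{r,\mathrm{per}}(0)=0$ and, for $k\ge 1$, $$\mu_r(k)=a_1+\cdots+a_{\min(v,r)},\qquad \mu_{r,\mathrm{per}}(k)=\begin{cases}a_1+\cdots+a_v+(r-v)a_v,&1\le v<r,\\ a_1+\cdots+a_r,&v\ge r.\end{cases}$$ Let $r>1$ be an integer. Let $\mathcal H_r$ be the Sobolev space of functions $f:[0,1]\to\mathbb R$ such that $f,f^{(1)},\ldots,f^{(r-1)}$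 are absolutely continuous and $f^{(r)}\in L_2([0,1])$, and let $\mathcal H_{r,\mathrm{per}}$ be the space of all $f\in\mathcal H_r$ with $\int_0^1f^{(s)}(x)\,dx=0$ for $0\le s<r$. Then for every $f\in\mathcal H_{r,\mathrm{per}}$ and every integer $k\ge 0$, $$|\hat f(k)|\le\int_0^1|f^{(r)}(x)|\,dx\cdot\frac{2b^{-\mu_{r,\mathrm{per}}(k)}}{(2\sin\frac{\pi}{b})^r}\left(1+\frac1b+\frac1{b(b+1)}\right)^{r-2}\left(\frac72+\frac2b+\frac{2b+1}{b-1}\right).$$ Moreover, $\mu_{r,\mathrm{per}}(k)\ge\mu_r(k)$ for every $k$, with strict inequality if and only if $1\le v<r$. -/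

import Mathlib

open MeasureTheory
open scoped ComplexConjugate

noncomputable section

namespace WalshDecay

/-- The coefficient of `b ^ (a - 1)` in the base `b` expansion of `k` (for `a ≥ 1`). -/
def natDigit (b k a : ℕ) : ℕ := k / b ^ (a - 1) % b

/-- The set `{a₁, …, a_v}` of the positions `a ≥ 1` at which the base `b` expansion
`k = κ₁ b ^ (a₁ - 1) + ⋯ + κ_v b ^ (a_v - 1)` has a nonzero digit. -/
def positions (b k : ℕ) : Finset ℕ :=
  (Finset.Icc 1 (Nat.digits b k).length).filter fun a => natDigit b k a ≠ 0

/-- The number `v` of nonzero base `b` digits of `k`. -/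
def numDigits (b k : ℕ) : ℕ := (positions b k).card

/-- The `i`-th largest position `a_i` of a nonzero digit, `1 ≤ i ≤ v`, so `a₁ > ⋯ > a_v > 0`. -/
def pos (b k i : ℕ) : ℕ := ((positions b k).sort (· ≥ ·)).getD (i - 1) 0

/-- The rate `μ_r(k)`. -/
def mu (b r k : ℕ) : ℕ :=
  if r = 0 ∨ k = 0 then 0
  else if numDigits b k ≤ r then ∑ i ∈ Finset.Icc 1 (numDigits b k), pos b k i
  else ∑ i ∈ Finset.Icc 1 r, pos b k i

/-- The rate `μ_{r,per}(k)`. -/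
def muPer (b r k : ℕ) : ℕ :=
  if r = 0 ∨ k = 0 then 0
  else if numDigits b k < r then
    (∑ i ∈ Finset.Icc 1 (numDigits b k), pos b k i)
      + (r - numDigits b k) * pos b k (numDigits b k)
  else ∑ i ∈ Finset.Icc 1 r, pos b k i

/-- The digit `x_a` (`a ≥ 1`) in the expansion `x = x₁ / b + x₂ / b ^ 2 + ⋯` of `x ∈ [0, 1)` in
which infinitely many digits differ from `b - 1`. -/
def realDigit (b : ℕ) (x : ℝ) (a : ℕ) : ℕ := ⌊x * (b : ℝ) ^ a⌋₊ % b

/-- The `k`-th Walsh function in base `b`: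
`wal_k(x) = ω_b ^ (κ₁ x_{a₁} + ⋯ + κ_v x_{a_v})` with `ω_b = exp (2πi / b)`. -/
def wal (b k : ℕ) (x : ℝ) : ℂ :=
  Complex.exp (2 * Real.pi * Complex.I / b) ^
    (∑ a ∈ positions b k, natDigit b k a * realDigit b x a)

/-- The `k`-th Walsh coefficient of `f : [0, 1] → ℝ`. -/
def walshCoeff (b : ℕ) (f : ℝ → ℝ) (k : ℕ) : ℂ :=
  ∫ x in (0 : ℝ)..1, (f x : ℂ) * conj (wal b k x)

/-- The `s`-th derivative of `f` on `[0, 1]` (one-sided at the end points). It does not see the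
values of `f` outside `[0, 1]`. -/
def derivI (s : ℕ) (f : ℝ → ℝ) : ℝ → ℝ := iteratedDerivWithin s f (Set.Icc 0 1)

/-- The Sobolev space `H_r`, `r ≥ 1`: the functions `f` on `[0, 1]` for which
`f, …, f^(r-1)` exist and are absolutely continuous, and `f^(r)`, which then exists almost
everywhere, is square integrable. -/
structure MemSobolev (r : ℕ) (f : ℝ → ℝ) : Prop where
  contDiffOn : ContDiffOn ℝ ((r - 1 : ℕ) : ℕ∞) f (Set.Icc 0 1)
  absolutelyContinuous : AbsolutelyContinuousOnInterval (derivI (r - 1) f) 0 1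
  memLp : MemLp (derivI r f) 2 (volume.restrict (Set.Icc 0 1))

/-- The space `H_{r,per}`. -/
structure MemSobolevPer (r : ℕ) (f : ℝ → ℝ) : Prop where
  memSobolev : MemSobolev r f
  integral_eq_zero : ∀ s < r, ∫ x in (0 : ℝ)..1, derivI s f x = 0

end WalshDecay

end

/-!
# Decay of the Walsh coefficients of smooth periodic functions

Let `S = (2 sin (π/b))⁻¹`, `D = 1 + 1/b + 1/(b(b+1))`, and let `a` be the leading position of
`k = κ b ^ (a - 1) + k'`. The conjugate of `wal_k` is constant on the cells of length `b⁻ᵃ`, and its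
primitive vanishing at `0` is

`b⁻ᵃ ((1 - z)⁻¹ (conj wal_{k'} - conj wal_k) + conj wal_k · {bᵃ x})`, where `z = ω_b^{-κ}`

(`integral_conj_wal`); it vanishes at `1` as well. Hence integration by parts, valid for absolutely
continuous functions, has no boundary terms, and it expresses the `k`-th Walsh coefficient of `F`
through integrals of `F'` against this primitive. The sawtooth `{bᵃ x} - 1/2` is expanded one base
`b` digit after the other, and each centred digit is a combination of the `b - 1` nontrivial
characters of `ℤ / b` with coefficients of absolute value at most `S` (`sub_half_eq_sum_rootInv`).
Multiplied by `conj wal_k`, these characters are the Walsh functions with index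
`j b ^ (a + c) + k`, `0 < j < b`, `c ≥ 0`. So the `k`-th coefficient of `F` is `b⁻ᵃ` times a
combination of the coefficients of `F'` with the indices `k'`, `k` and `j b ^ (a + c) + k`, with
coefficients at most `S`, `S` and `S b ^ (-c - 1)` (`walshCoeff_eq`, `sawCoeff_eq`).

The estimate follows by induction on the number `i` of derivatives used, from `f^(r-1)` down to `f`.
For `i = 1` the primitive is bounded by `4 S b⁻ᵃ`. For the step, write the periodic rate as a
recursive function of the list of positions (`perRate`): it obeys
`μ_{i+1}(a :: l) = a + μ_i(l)` for `l ≠ []`, while the indices `k` and `j b ^ (a + c) + k` gain at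
least `1` and `c + 2` over `a + μ_i(l)`. As there are `b - 1` choices of `j`, the three
contributions add up to at most
`S (1 + 1/b + (b - 1) ∑_c b ^ (-2c - 3)) = S D`. If `k` has a single nonzero digit then `k' = 0`,
and its coefficient vanishes because the derivatives of order less than `r` have mean zero; the
other two contributions add up to at most `S (1 + 1/(b + 1)) ≤ S D`. Altogether
`|f̂(k)| ≤ 4 Sʳ D ^ (r-1) b ^ (-μ_{r,per}(k)) ∫ |f^(r)|`, which is stronger than the claim since
`4 D ≤ 20/3 < 2 · 7/2`.
-/

namespace WalshDecay

/-! ### Base `b` digits and the positions of the nonzero ones -/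

section Digits

variable {b : ℕ}

theorem natDigit_leading (n κ k' : ℕ) (hb : 2 ≤ b) (hκ : κ < b) (hk' : k' < b ^ n)
    {a : ℕ} (ha : 1 ≤ a) :
    natDigit b (κ * b ^ n + k') a = if a = n + 1 then κ else natDigit b k' a := by
  unfold natDigit
  have hbp : ∀ m, 0 < b ^ m := fun m => by positivity
  obtain ⟨a, rfl⟩ : ∃ c, a = c + 1 := ⟨a - 1, by omega⟩
  simp only [Nat.add_sub_cancel, Nat.add_right_cancel_iff]
  rcases lt_trichotomy a n with h | h | h
  · obtain ⟨d, rfl⟩ : ∃ d, n = a + (d + 1) := ⟨n - a - 1, by omega⟩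
    have h1 : κ * b ^ (a + (d + 1)) + k' = k' + b ^ a * (b * (κ * b ^ d)) := by ring
    rw [if_neg (by omega), h1, Nat.add_mul_div_left _ _ (hbp a), Nat.add_mul_mod_self_left]
  · subst h
    rw [if_pos rfl, add_comm, Nat.add_mul_div_right _ _ (hbp a), Nat.div_eq_of_lt hk',
      zero_add, Nat.mod_eq_of_lt hκ]
  · have h1 : κ * b ^ n + k' < b ^ (n + 1) := by
      rw [pow_succ]
      nlinarith [Nat.mul_le_mul_right (b ^ n) (Nat.succ_le_of_lt hκ)]
    have h2 : b ^ (n + 1) ≤ b ^ a := Nat.pow_le_pow_right (by omega) h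
    rw [if_neg (by omega), Nat.div_eq_of_lt (by omega), Nat.div_eq_of_lt (by omega)]

theorem natDigit_eq_zero {k n a : ℕ} (hk : k < b ^ n) (hb : 2 ≤ b) (ha : n < a) :
    natDigit b k a = 0 := by
  have : b ^ n ≤ b ^ (a - 1) := Nat.pow_le_pow_right (by omega) (by omega)
  rw [natDigit, Nat.div_eq_of_lt (by omega), Nat.zero_mod]

theorem mem_positions (hb : 2 ≤ b) {k a : ℕ} :
    a ∈ positions b k ↔ 1 ≤ a ∧ natDigit b k a ≠ 0 := by
  simp only [positions, Finset.mem_filter, Finset.mem_Icc]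
  refine ⟨fun h => ⟨h.1.1, h.2⟩, fun h => ⟨⟨h.1, ?_⟩, h.2⟩⟩
  by_contra hlt
  exact h.2 (natDigit_eq_zero (Nat.lt_base_pow_length_digits hb) hb (by omega))

theorem le_of_mem_positions (hb : 2 ≤ b) {k n a : ℕ} (hk : k < b ^ n) (ha : a ∈ positions b k) :
    a ≤ n := by
  by_contra hlt
  exact ((mem_positions hb).1 ha).2 (natDigit_eq_zero hk hb (by omega))

theorem positions_leading {n κ k' : ℕ} (hb : 2 ≤ b) (hκ0 : κ ≠ 0) (hκ : κ < b) (hk' : k' < b ^ n) :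
    positions b (κ * b ^ n + k') = insert (n + 1) (positions b k') := by
  ext a
  rw [Finset.mem_insert, mem_positions hb, mem_positions hb]
  constructor
  · rintro ⟨h1, h2⟩
    rw [natDigit_leading n κ k' hb hκ hk' h1] at h2
    split_ifs at h2 with h
    · exact Or.inl h
    · exact Or.inr ⟨h1, h2⟩
  · rintro (h | ⟨h1, h2⟩)
    · subst h
      rw [natDigit_leading n κ k' hb hκ hk' (by omega), if_pos rfl]
      exact ⟨by omega, hκ0⟩
    · refine ⟨h1, ?_⟩
      rw [natDigit_leading n κ k' hb hκ hk' h1]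
      split_ifs with h
      exacts [hκ0, h2]

/-- The positions `a₁ > ⋯ > a_v` of the nonzero base `b` digits of `k`, as a list. -/
def posList (b k : ℕ) : List ℕ := (positions b k).sort (· ≥ ·)

theorem posList_leading {n κ k' : ℕ} (hb : 2 ≤ b) (hκ0 : κ ≠ 0) (hκ : κ < b) (hk' : k' < b ^ n) :
    posList b (κ * b ^ n + k') = (n + 1) :: posList b k' := by
  rw [posList, positions_leading hb hκ0 hκ hk', Finset.sort_insert, posList]
  · intro c hc
    have := le_of_mem_positions hb hk' hc
    show n + 1 ≥ c
    omega
  · intro hc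
    have := le_of_mem_positions hb hk' hc
    omega

theorem posList_zero (b : ℕ) : posList b 0 = [] := by
  simp [posList, positions]

theorem sortedGT_posList (b k : ℕ) : (posList b k).Pairwise (· > ·) :=
  (Finset.sortedGT_sort (positions b k)).pairwise

theorem one_le_of_mem_posList {b k a : ℕ} (h : a ∈ posList b k) : 1 ≤ a := by
  rw [posList, Finset.mem_sort, positions, Finset.mem_filter, Finset.mem_Icc] at h
  exact h.1.1

/-- Splitting off the leading digit `κ` of `k`. -/
theorem exists_leading_digit (hb : 2 ≤ b) {k : ℕ} (hk : k ≠ 0) :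
    ∃ n κ k', κ ≠ 0 ∧ κ < b ∧ k' < b ^ n ∧ k = κ * b ^ n + k' := by
  refine ⟨Nat.log b k, k / b ^ Nat.log b k, k % b ^ Nat.log b k, ?_, ?_, ?_, ?_⟩
  · exact (Nat.div_pos (Nat.pow_log_le_self b hk) (by positivity)).ne'
  · rw [Nat.div_lt_iff_lt_mul (by positivity), mul_comm, ← pow_succ]
    exact Nat.lt_pow_succ_log_self (by omega) k
  · exact Nat.mod_lt _ (by positivity)
  · rw [mul_comm]
    exact (Nat.div_add_mod k _).symm

theorem leading_lt_pow {n κ k' : ℕ} (hκ : κ < b) (hk' : k' < b ^ n) :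
    κ * b ^ n + k' < b ^ (n + 1) := by
  rw [pow_succ]
  nlinarith [Nat.mul_le_mul_right (b ^ n) (Nat.succ_le_of_lt hκ)]

theorem posList_ne_nil (hb : 2 ≤ b) {k : ℕ} (hk : k ≠ 0) : posList b k ≠ [] := by
  obtain ⟨n, κ, k', hκ0, hκ, hk', rfl⟩ := exists_leading_digit hb hk
  rw [posList_leading hb hκ0 hκ hk']
  exact List.cons_ne_nil _ _

end Digits

/-! ### The periodic rate by recursion on the leading digit -/

/-- The rate `μ_{r,per}` of an integer whose nonzero digits are at the positions `a₁ > ⋯ > a_v`,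
as a function of the list of these positions. -/
def perRate : ℕ → List ℕ → ℕ
  | 0, _ => 0
  | _ + 1, [] => 0
  | r + 1, [a] => (r + 1) * a
  | r + 1, a :: c :: l => a + perRate r (c :: l)

theorem perRate_singleton (r a : ℕ) : perRate r [a] = r * a := by
  cases r <;> simp [perRate]

theorem perRate_succ_cons (r a : ℕ) {l : List ℕ} (hl : l ≠ []) :
    perRate (r + 1) (a :: l) = a + perRate r l := by
  cases l with
  | nil => exact absurd rfl hl
  | cons c l => rfl

theorem perRate_le_cons (r a : ℕ) {l : List ℕ} (h : (a :: l).Pairwise (· > ·)) :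
    perRate r l ≤ perRate r (a :: l) := by
  induction r generalizing a l with
  | zero => simp [perRate]
  | succ r ih =>
    cases l with
    | nil => simp [perRate]
    | cons c l =>
      have hac : c < a := (List.pairwise_cons.1 h).1 c (by simp)
      have hcl := (List.pairwise_cons.1 h).2
      rw [perRate_succ_cons r a (List.cons_ne_nil c l)]
      cases l with
      | nil =>
        rw [perRate_singleton, perRate_singleton]
        nlinarith
      | cons d l =>
        rw [perRate_succ_cons r c (List.cons_ne_nil d l)]
        have := ih c hcl
        omega

theorem perRate_succ_lt_cons (r a : ℕ) {l : List ℕ} (h : (a :: l).Pairwise (· > ·)) (hl : l ≠ []) :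
    perRate (r + 1) l < perRate (r + 1) (a :: l) := by
  cases l with
  | nil => exact absurd rfl hl
  | cons c l =>
    have hac : c < a := (List.pairwise_cons.1 h).1 c (by simp)
    have hcl := (List.pairwise_cons.1 h).2
    rw [perRate_succ_cons r a (List.cons_ne_nil c l)]
    cases l with
    | nil =>
      rw [perRate_singleton, perRate_singleton]
      nlinarith
    | cons d l =>
      rw [perRate_succ_cons r c (List.cons_ne_nil d l)]
      have := perRate_le_cons r c hcl
      omega

theorem sum_Icc_getD (l : List ℕ) {r : ℕ} (h : r ≤ l.length) :
    ∑ i ∈ Finset.Icc 1 r, l.getD (i - 1) 0 = (l.take r).sum := by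
  induction r with
  | zero => simp
  | succ r ih =>
    rw [Finset.sum_Icc_succ_top (by omega), ih (by omega), List.sum_take_succ _ _ (by omega),
      Nat.add_sub_cancel, List.getD_eq_getElem _ _ (by omega)]

theorem perRate_eq (r : ℕ) (l : List ℕ) :
    perRate r l = if l.length < r then l.sum + (r - l.length) * l.getD (l.length - 1) 0
      else (l.take r).sum := by
  induction r generalizing l with
  | zero => simp [perRate]
  | succ r ih =>
    cases l with
    | nil => simp [perRate]
    | cons a l =>
      cases l with
      | nil =>
        rw [perRate_singleton]
        by_cases hr : r = 0
        · simp [hr]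
        · rw [if_pos (by simp; omega)]
          simp
          ring
      | cons c l =>
        rw [perRate_succ_cons r a (List.cons_ne_nil c l), ih]
        by_cases h : (c :: l).length < r
        · rw [if_pos h, if_pos (by simpa using h)]
          simp [add_assoc]
        · rw [if_neg h, if_neg (by simpa using h)]
          simp

theorem length_posList (b k : ℕ) : (posList b k).length = numDigits b k := by
  rw [posList, Finset.length_sort, numDigits]

theorem sum_pos {b k m : ℕ} (hm : m ≤ numDigits b k) :
    ∑ i ∈ Finset.Icc 1 m, pos b k i = ((posList b k).take m).sum :=
  sum_Icc_getD (posList b k) (by rwa [length_posList])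

theorem muPer_eq_perRate (b r k : ℕ) : muPer b r k = perRate r (posList b k) := by
  unfold muPer
  split_ifs with h h'
  · rcases h with rfl | rfl
    · simp [perRate]
    · rw [posList_zero]
      cases r <;> simp [perRate]
  · rw [perRate_eq, length_posList, if_pos h', sum_pos le_rfl, ← length_posList, List.take_length]
    rw [length_posList]
    rfl
  · rw [perRate_eq, length_posList, if_neg h', sum_pos (by omega)]

/-- `μ_{r,per}` exceeds `μ_r` by `(r - v) a_v` if `1 ≤ v < r`, and agrees with it otherwise. -/
theorem mu_le_muPer {b : ℕ} (hb : 2 ≤ b) (r k : ℕ) :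
    mu b r k ≤ muPer b r k ∧
      (mu b r k < muPer b r k ↔ 1 ≤ numDigits b k ∧ numDigits b k < r) := by
  unfold mu muPer
  by_cases h0 : r = 0 ∨ k = 0
  · rw [if_pos h0, if_pos h0]
    refine ⟨le_rfl, ?_⟩
    rcases h0 with rfl | rfl
    · simp
    · simp [numDigits, positions]
  · rw [if_neg h0, if_neg h0]
    rcases lt_trichotomy (numDigits b k) r with h | h | h
    · have hv : 1 ≤ numDigits b k := by
        rw [← length_posList]
        exact List.length_pos_iff.2 (posList_ne_nil hb (by tauto))
      have hlt : numDigits b k - 1 < (posList b k).length := by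
        rw [length_posList]
        omega
      have hp : 1 ≤ pos b k (numDigits b k) := by
        have : pos b k (numDigits b k) = (posList b k)[numDigits b k - 1] :=
          List.getD_eq_getElem _ _ hlt
        rw [this]
        exact one_le_of_mem_posList (List.getElem_mem _)
      rw [if_pos h.le, if_pos h]
      have : 0 < (r - numDigits b k) * pos b k (numDigits b k) :=
        Nat.mul_pos (by omega) (by omega)
      refine ⟨by omega, ?_⟩
      constructor
      · exact fun _ => ⟨hv, h⟩
      · exact fun _ => by omega
    · subst h
      simp
    · rw [if_neg (by omega), if_neg (by omega)]
      refine ⟨le_rfl, ?_⟩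
      constructor
      · intro h'
        exact absurd h' (lt_irrefl _)
      · omega

/-! ### Roots of unity and the sawtooth function on `ℤ / b` -/

section Roots

variable {b : ℕ}

/-- The root of unity `ω_b⁻¹ = exp (-2πi / b)`, whose powers are the conjugated Walsh functions. -/
noncomputable def rootInv (b : ℕ) : ℂ := conj (Complex.exp (2 * Real.pi * Complex.I / b))

theorem rootInv_isPrimitiveRoot (hb : 2 ≤ b) : IsPrimitiveRoot (rootInv b) b :=
  (Complex.isPrimitiveRoot_exp b (by omega)).map_of_injective (starRingEnd ℂ).injective

theorem norm_rootInv (hb : 2 ≤ b) : ‖rootInv b‖ = 1 :=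
  (rootInv_isPrimitiveRoot hb).norm'_eq_one (by omega)

theorem sin_pi_div_pos (hb : 2 ≤ b) : 0 < Real.sin (Real.pi / b) := by
  have hb' : (2 : ℝ) ≤ b := by exact_mod_cast hb
  apply Real.sin_pos_of_pos_of_lt_pi (by positivity)
  rw [div_lt_iff₀ (by linarith)]
  nlinarith [Real.pi_pos]

theorem sin_pi_div_le_sin_mul (hb : 2 ≤ b) {m : ℕ} (hm : m ≠ 0) (hmb : m < b) :
    Real.sin (Real.pi / b) ≤ Real.sin (Real.pi * m / b) := by
  have hb' : (0 : ℝ) < b := by exact_mod_cast (by omega : 0 < b)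
  -- It suffices to treat `m ≤ b / 2`, where the sine is increasing.
  have key : ∀ j : ℕ, 1 ≤ j → 2 * j ≤ b → Real.sin (Real.pi / b) ≤ Real.sin (Real.pi * j / b) := by
    intro j hj hjb
    have hj' : (1 : ℝ) ≤ j := by exact_mod_cast hj
    have hjb' : 2 * (j : ℝ) ≤ b := by exact_mod_cast hjb
    apply Real.sin_le_sin_of_le_of_le_pi_div_two
    · have : 0 < Real.pi / b := by positivity
      linarith [Real.pi_pos]
    · rw [div_le_div_iff₀ hb' two_pos]
      nlinarith [Real.pi_pos]
    · gcongr
      nlinarith [Real.pi_pos]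
  rcases le_total (2 * m) b with h | h
  · exact key m (by omega) h
  · have := key (b - m) (by omega) (by omega)
    rw [Nat.cast_sub hmb.le] at this
    have h2 : Real.pi * (b - m) / b = Real.pi - Real.pi * m / b := by
      field_simp
    rwa [h2, Real.sin_pi_sub] at this

theorem two_sin_le_norm_one_sub (hb : 2 ≤ b) {m : ℕ} (hm : m ≠ 0) (hmb : m < b) :
    2 * Real.sin (Real.pi / b) ≤ ‖1 - rootInv b ^ m‖ := by
  have h : rootInv b ^ m = conj (Complex.exp (Complex.I * ((2 * Real.pi * m / b : ℝ) : ℂ))) := by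
    rw [rootInv, ← map_pow, ← Complex.exp_nat_mul]
    congr 2
    push_cast
    ring
  rw [h, norm_sub_rev, ← map_one (starRingEnd ℂ), ← map_sub, RCLike.norm_conj,
    Complex.norm_exp_I_mul_ofReal_sub_one]
  have h2 : 2 * Real.pi * m / b / 2 = Real.pi * m / b := by ring
  rw [h2]
  refine le_trans ?_ (le_abs_self _)
  linarith [sin_pi_div_le_sin_mul hb hm hmb]

theorem one_sub_rootInv_pow_ne_zero (hb : 2 ≤ b) {m : ℕ} (hm : m ≠ 0) (hmb : m < b) :
    1 - rootInv b ^ m ≠ 0 := by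
  have := two_sin_le_norm_one_sub hb hm hmb
  have h2 := sin_pi_div_pos hb
  exact norm_pos_iff.1 (by linarith)

theorem norm_inv_one_sub_le (hb : 2 ≤ b) {m : ℕ} (hm : m ≠ 0) (hmb : m < b) :
    ‖(1 - rootInv b ^ m)⁻¹‖ ≤ (2 * Real.sin (Real.pi / b))⁻¹ := by
  rw [norm_inv]
  have := sin_pi_div_pos hb
  exact inv_anti₀ (by positivity) (two_sin_le_norm_one_sub hb hm hmb)

/-- The constant `1/2 - (1 - z)⁻¹ = -(1 + z) / (2 (1 - z))` is no larger than `(1 - z)⁻¹` for `z` on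
the unit circle. -/
theorem norm_half_sub_inv_le (hb : 2 ≤ b) {m : ℕ} (hm : m ≠ 0) (hmb : m < b) :
    ‖1 / 2 - (1 - rootInv b ^ m)⁻¹‖ ≤ (2 * Real.sin (Real.pi / b))⁻¹ := by
  have h0 := one_sub_rootInv_pow_ne_zero hb hm hmb
  have h : 1 / 2 - (1 - rootInv b ^ m)⁻¹ = -((1 + rootInv b ^ m) / 2) * (1 - rootInv b ^ m)⁻¹ := by
    field_simp
    ring
  have h1 : ‖-((1 + rootInv b ^ m) / 2)‖ ≤ 1 := by
    rw [norm_neg, norm_div]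
    have := norm_add_le (1 : ℂ) (rootInv b ^ m)
    rw [norm_pow, norm_rootInv hb] at this
    norm_num at this ⊢
    linarith
  rw [h, norm_mul]
  calc _ ≤ 1 * ‖(1 - rootInv b ^ m)⁻¹‖ := by gcongr
    _ ≤ _ := by rw [one_mul]; exact norm_inv_one_sub_le hb hm hmb

/-- The finite Fourier expansion of the centred identity function on `{0, …, b - 1}`. -/
theorem sub_half_eq_sum_rootInv (hb : 2 ≤ b) {d : ℕ} (hd : d < b) :
    (d : ℂ) - ((b : ℂ) - 1) / 2 = ∑ j ∈ Finset.Ico 1 b,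
      rootInv b ^ j / (1 - rootInv b ^ j) * rootInv b ^ (j * d) := by
  have hprim := rootInv_isPrimitiveRoot hb
  have h0 : rootInv b ≠ 0 := hprim.ne_zero (by omega)
  induction d with
  | zero =>
    -- The terms for `j` and `b - j` add up to `-1`.
    set g : ℕ → ℂ := fun j => rootInv b ^ j / (1 - rootInv b ^ j) with hg
    have h1 : ∑ j ∈ Finset.Ico 1 b, g (b - j) = ∑ j ∈ Finset.Ico 1 b, g j := by
      have := Finset.sum_Ico_reflect g 1 (show b ≤ b + 1 by omega)
      rw [this]
      congr 2
      omega
    have h2 : ∑ j ∈ Finset.Ico 1 b, (g j + g (b - j)) = -((b : ℂ) - 1) := by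
      have : ∀ j ∈ Finset.Ico 1 b, g j + g (b - j) = -1 := by
        intro j hj
        rw [Finset.mem_Ico] at hj
        have hne := one_sub_rootInv_pow_ne_zero hb (show j ≠ 0 by omega) hj.2
        have hinv : rootInv b ^ (b - j) = (rootInv b ^ j)⁻¹ := by
          refine eq_inv_of_mul_eq_one_left ?_
          rw [← pow_add, Nat.sub_add_cancel hj.2.le, hprim.pow_eq_one]
        have hj0 := pow_ne_zero j h0
        have hne' : rootInv b ^ j - 1 ≠ 0 := by
          rw [← neg_sub]
          exact neg_ne_zero.2 hne
        have hinv' : g (b - j) = 1 / (rootInv b ^ j - 1) := by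
          simp only [hg]
          rw [hinv]
          have : 1 - (rootInv b ^ j)⁻¹ = (rootInv b ^ j - 1) * (rootInv b ^ j)⁻¹ := by
            field_simp
          rw [this]
          field_simp
        rw [hinv', ← neg_sub 1 (rootInv b ^ j)]
        simp only [hg]
        field_simp
        ring
      rw [Finset.sum_congr rfl this]
      simp only [Finset.sum_const, Nat.card_Ico, nsmul_eq_mul]
      rw [Nat.cast_sub (by omega)]
      push_cast
      ring
    rw [Finset.sum_add_distrib, h1] at h2
    simp only [Nat.mul_zero, pow_zero, mul_one, Nat.cast_zero, zero_sub]
    linear_combination -h2 / 2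
  | succ d ih =>
    have ih := ih (by omega)
    have hgeom : ∑ j ∈ Finset.Ico 1 b, rootInv b ^ (j * (d + 1)) = -1 := by
      have hne := one_sub_rootInv_pow_ne_zero hb (Nat.succ_ne_zero d) hd
      have h1 : ∑ j ∈ Finset.range b, (rootInv b ^ (d + 1)) ^ j = 0 := by
        have h2 := mul_neg_geom_sum (rootInv b ^ (d + 1)) b
        rw [← pow_mul, mul_comm (d + 1) b, pow_mul, hprim.pow_eq_one, one_pow, sub_self] at h2
        exact (mul_eq_zero.1 h2).resolve_left hne
      rw [Finset.range_eq_Ico, Finset.sum_eq_sum_Ico_succ_bot (by omega)] at h1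
      simp only [pow_zero, zero_add, ← pow_mul, mul_comm (d + 1)] at h1
      linear_combination h1
    have hdiff : ∑ j ∈ Finset.Ico 1 b,
          rootInv b ^ j / (1 - rootInv b ^ j) * rootInv b ^ (j * (d + 1))
        - ∑ j ∈ Finset.Ico 1 b, rootInv b ^ j / (1 - rootInv b ^ j) * rootInv b ^ (j * d)
        = - ∑ j ∈ Finset.Ico 1 b, rootInv b ^ (j * (d + 1)) := by
      rw [← Finset.sum_sub_distrib, ← Finset.sum_neg_distrib]
      refine Finset.sum_congr rfl fun j hj => ?_
      rw [Finset.mem_Ico] at hj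
      have hne := one_sub_rootInv_pow_ne_zero hb (show j ≠ 0 by omega) hj.2
      rw [mul_add, mul_one, pow_add]
      field_simp
      ring
    rw [hgeom, ← ih] at hdiff
    push_cast
    linear_combination -hdiff

/-- The values of a Walsh function whose leading digit is `κ`, with `z = ω_b^{-κ}`, sum up over an
initial segment of cells of length `b⁻ⁿ⁻¹`: full periods cancel, the rest is a geometric sum. -/
theorem sum_range_pow_mod_mul (hb : 2 ≤ b) {z : ℂ} (hz : z ^ b = 1) (hz1 : 1 - z ≠ 0) (V : ℕ → ℂ)
    (M : ℕ) : ∑ m ∈ Finset.range M, z ^ (m % b) * V (m / b)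
      = (1 - z)⁻¹ * (V (M / b) - z ^ (M % b) * V (M / b)) := by
  induction M with
  | zero => simp
  | succ M ih =>
    rw [Finset.sum_range_succ, ih]
    by_cases h : b ∣ M + 1
    · have h1 : (M + 1) % b = 0 := Nat.mod_eq_zero_of_dvd h
      have h2 : M % b + 1 = b := by
        obtain ⟨c, hc⟩ := h
        obtain ⟨e, rfl⟩ : ∃ e, c = e + 1 := ⟨c - 1, by
          rcases c with _ | c <;> omega⟩
        have h3 : M = (b - 1) + b * e := by
          rw [mul_add, mul_one] at hc
          omega
        rw [h3, Nat.add_mul_mod_self_left, Nat.mod_eq_of_lt (by omega)]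
        omega
      rw [h1]
      have h3 : z ^ (M % b) * z = 1 := by rw [← pow_succ, h2, hz]
      field_simp
      linear_combination (-(V (M / b))) * h3
    · have h1 : (M + 1) / b = M / b := Nat.succ_div_of_not_dvd h
      have h2 : (M + 1) % b = M % b + 1 := by
        have e1 := Nat.div_add_mod (M + 1) b
        have e2 := Nat.div_add_mod M b
        rw [h1] at e1
        omega
      rw [h1, h2, pow_succ]
      field_simp
      ring

end Roots

/-! ### Walsh functions as step functions -/

section Walsh

variable {b : ℕ}

theorem realDigit_eq_floor_div (hb : 2 ≤ b) (x : ℝ) {a A : ℕ} (h : a ≤ A) :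
    realDigit b x a = ⌊x * (b : ℝ) ^ A⌋₊ / b ^ (A - a) % b := by
  have hb' : (b : ℝ) ≠ 0 := by exact_mod_cast (by omega : b ≠ 0)
  rw [realDigit, ← Nat.floor_div_natCast]
  congr 2
  obtain ⟨d, rfl⟩ := Nat.exists_eq_add_of_le h
  rw [Nat.add_sub_cancel_left, Nat.cast_pow, pow_add]
  field_simp

theorem conj_wal (b k : ℕ) (x : ℝ) :
    conj (wal b k x) = rootInv b ^ (∑ a ∈ positions b k, natDigit b k a * realDigit b x a) := by
  rw [wal, map_pow, rootInv]

theorem wal_zero (b : ℕ) (x : ℝ) : wal b 0 x = 1 := by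
  simp [wal, positions]

theorem norm_conj_wal (hb : 2 ≤ b) (k : ℕ) (x : ℝ) : ‖conj (wal b k x)‖ = 1 := by
  rw [conj_wal, norm_pow, norm_rootInv hb, one_pow]

theorem conj_wal_leading {n κ k' : ℕ} (hb : 2 ≤ b) (hκ0 : κ ≠ 0) (hκ : κ < b) (hk' : k' < b ^ n)
    (x : ℝ) : conj (wal b (κ * b ^ n + k') x)
      = rootInv b ^ (κ * realDigit b x (n + 1)) * conj (wal b k' x) := by
  have hnot : n + 1 ∉ positions b k' := fun h => by
    have := le_of_mem_positions hb hk' h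
    omega
  rw [conj_wal, conj_wal, ← pow_add, positions_leading hb hκ0 hκ hk', Finset.sum_insert hnot,
    natDigit_leading n κ k' hb hκ hk' (by omega), if_pos rfl]
  congr 2
  refine Finset.sum_congr rfl fun a ha => ?_
  rw [natDigit_leading n κ k' hb hκ hk' ((mem_positions hb).1 ha).1, if_neg]
  rintro rfl
  exact hnot ha

/-- For `k < bⁿ` the function `wal_k` is constant on the cells `[j b⁻ⁿ, (j + 1) b⁻ⁿ)`. -/
theorem wal_eq_wal_floor {n k : ℕ} (hb : 2 ≤ b) (hk : k < b ^ n) (x : ℝ) :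
    wal b k x = wal b k ((⌊x * (b : ℝ) ^ n⌋₊ : ℝ) / (b : ℝ) ^ n) := by
  have hb' : (b : ℝ) ≠ 0 := by exact_mod_cast (by omega : b ≠ 0)
  rw [wal, wal]
  congr 1
  refine Finset.sum_congr rfl fun a ha => ?_
  have := le_of_mem_positions hb hk ha
  rw [realDigit_eq_floor_div hb x this, realDigit_eq_floor_div hb _ this,
    div_mul_cancel₀ _ (pow_ne_zero _ hb'), Nat.floor_natCast]

theorem measurable_conj_wal (b k : ℕ) : Measurable fun x => conj (wal b k x) := by
  have h1 : ∀ a, Measurable fun x => realDigit b x a := fun a =>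
    (measurable_from_top (f := fun m : ℕ => m % b)).comp
      (Nat.measurable_floor.comp (measurable_id.mul_const _))
  have h2 : Measurable fun x => ∑ a ∈ positions b k, natDigit b k a * realDigit b x a :=
    Finset.measurable_sum _ fun a _ => (h1 a).const_mul _
  simp only [conj_wal]
  exact (measurable_from_top (f := fun m : ℕ => rootInv b ^ m)).comp h2

theorem intervalIntegrable_of_bounded {g : ℝ → ℂ} (hg : Measurable g) {C : ℝ}
    (hC : ∀ x, ‖g x‖ ≤ C) (u v : ℝ) : IntervalIntegrable g volume u v :=
  intervalIntegrable_const.mono_fun (g := g) (f := fun _ => C) hg.aestronglyMeasurable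
    (Filter.Eventually.of_forall fun x => (hC x).trans (le_abs_self C))

/-- The primitive of a step function with steps at the integers. -/
theorem integral_comp_floor (g : ℕ → ℂ) {y : ℝ} (hy : 0 ≤ y) :
    ∫ t in (0 : ℝ)..y, g ⌊t⌋₊
      = ∑ m ∈ Finset.range ⌊y⌋₊, g m + g ⌊y⌋₊ * (Int.fract y : ℝ) := by
  have hpiece : ∀ (m : ℕ) (u : ℝ), m ≤ u → u ≤ m + 1 →
      IntervalIntegrable (fun t : ℝ => g ⌊t⌋₊) volume m u ∧
        ∫ t in (m : ℝ)..u, g ⌊t⌋₊ = g m * ((u - m : ℝ) : ℂ) := by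
    intro m u h1 h2
    have heq : Set.EqOn (fun _ : ℝ => g m) (fun t : ℝ => g ⌊t⌋₊) (Set.uIoo (m : ℝ) u) := by
      intro t ht
      rw [Set.uIoo_of_le h1] at ht
      have : ⌊t⌋₊ = m := (Nat.floor_eq_iff (by linarith [ht.1, m.cast_nonneg (α := ℝ)])).2
        ⟨ht.1.le, by linarith [ht.2]⟩
      simp only [this]
    refine ⟨intervalIntegrable_const.congr_uIoo heq, ?_⟩
    rw [← intervalIntegral.integral_congr_uIoo heq, intervalIntegral.integral_const,
      Complex.real_smul, mul_comm]
  have hfl := Nat.floor_le hy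
  have hfl' := (Nat.lt_floor_add_one y).le
  have hint : ∀ m < ⌊y⌋₊,
      IntervalIntegrable (fun t : ℝ => g ⌊t⌋₊) volume (m : ℕ) ((m + 1 : ℕ) : ℝ) :=
    fun m _ => (hpiece m _ (by push_cast; linarith) (by push_cast; linarith)).1
  have hsum := intervalIntegral.sum_integral_adjacent_intervals (a := fun m : ℕ => (m : ℝ)) hint
  have hint' := IntervalIntegrable.trans_iterate (a := fun m : ℕ => (m : ℝ)) hint
  simp only [Nat.cast_zero] at hsum hint'
  rw [← intervalIntegral.integral_add_adjacent_intervals hint' (hpiece _ y hfl hfl').1, ← hsum,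
    (hpiece _ y hfl hfl').2]
  congr 1
  · refine Finset.sum_congr rfl fun m _ => ?_
    rw [(hpiece m _ (by push_cast; linarith) (by push_cast; linarith)).2]
    push_cast
    ring
  · rw [← Int.self_sub_floor, natCast_floor_eq_intCast_floor hy]

/-- The primitive of `conj wal_k` that vanishes at `0`, where `κ b ⁿ` is the leading term of `k` and
`k' = k - κ b ⁿ`. -/
theorem integral_conj_wal {n κ k' : ℕ} (hb : 2 ≤ b) (hκ0 : κ ≠ 0) (hκ : κ < b) (hk' : k' < b ^ n)
    {x : ℝ} (hx : 0 ≤ x) :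
    ∫ t in (0 : ℝ)..x, conj (wal b (κ * b ^ n + k') t)
      = ((b : ℂ) ^ (n + 1))⁻¹ * ((1 - rootInv b ^ κ)⁻¹ *
          (conj (wal b k' x) - conj (wal b (κ * b ^ n + k') x))
        + conj (wal b (κ * b ^ n + k') x) * (Int.fract (x * (b : ℝ) ^ (n + 1)) : ℝ)) := by
  have hb' : (b : ℝ) ≠ 0 := by exact_mod_cast (by omega : b ≠ 0)
  set V : ℕ → ℂ := fun j => conj (wal b k' ((j : ℝ) / (b : ℝ) ^ n)) with hV
  have hk'V : ∀ t : ℝ, conj (wal b k' t) = V (⌊t * (b : ℝ) ^ (n + 1)⌋₊ / b) := by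
    intro t
    have hfl : ⌊t * (b : ℝ) ^ n⌋₊ = ⌊t * (b : ℝ) ^ (n + 1)⌋₊ / b := by
      rw [← Nat.floor_div_natCast, pow_succ, ← mul_assoc, mul_div_cancel_right₀ _ hb']
    rw [wal_eq_wal_floor hb hk' t, hfl]
  have hkV : ∀ t : ℝ, conj (wal b (κ * b ^ n + k') t)
      = (fun m : ℕ => (rootInv b ^ κ) ^ (m % b) * V (m / b)) ⌊t * (b : ℝ) ^ (n + 1)⌋₊ := by
    intro t
    rw [conj_wal_leading hb hκ0 hκ hk', hk'V, pow_mul, realDigit]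
  have hz : (rootInv b ^ κ) ^ b = 1 := by
    rw [← pow_mul, mul_comm, pow_mul, (rootInv_isPrimitiveRoot hb).pow_eq_one, one_pow]
  rw [hkV x, hk'V x]
  simp only [hkV]
  rw [intervalIntegral.integral_comp_mul_right
    (fun t : ℝ => (rootInv b ^ κ) ^ (⌊t⌋₊ % b) * V (⌊t⌋₊ / b)) (pow_ne_zero _ hb'), zero_mul,
    integral_comp_floor (fun m : ℕ => (rootInv b ^ κ) ^ (m % b) * V (m / b)) (by positivity),
    sum_range_pow_mod_mul hb hz (one_sub_rootInv_pow_ne_zero hb hκ0 hκ), Complex.real_smul]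
  push_cast
  rfl

theorem realDigit_one {a : ℕ} (ha : 1 ≤ a) : realDigit b 1 a = 0 := by
  rw [realDigit, one_mul, ← Nat.cast_pow, Nat.floor_natCast]
  exact Nat.mod_eq_zero_of_dvd (dvd_pow_self b (by omega))

theorem wal_one (b k : ℕ) : wal b k 1 = 1 := by
  rw [wal, Finset.sum_eq_zero, pow_zero]
  intro a ha
  rw [positions, Finset.mem_filter, Finset.mem_Icc] at ha
  rw [realDigit_one ha.1.1, mul_zero]

theorem integral_conj_wal_eq_zero (hb : 2 ≤ b) {k : ℕ} (hk : k ≠ 0) :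
    ∫ t in (0 : ℝ)..1, conj (wal b k t) = 0 := by
  obtain ⟨n, κ, k', hκ0, hκ, hk', rfl⟩ := exists_leading_digit hb hk
  have hfract : Int.fract ((b : ℝ) ^ (n + 1)) = 0 := by
    rw [← Nat.cast_pow, Int.fract_natCast]
  rw [integral_conj_wal hb hκ0 hκ hk' zero_le_one, wal_one, wal_one, one_mul, hfract]
  simp

end Walsh

/-! ### Integration by parts -/

theorem integral_mul_eq_neg_integral_deriv_mul_primitive {F v : ℝ → ℝ}
    (hF : AbsolutelyContinuousOnInterval F 0 1) (hv : IntervalIntegrable v volume 0 1)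
    (hv0 : ∫ x in (0 : ℝ)..1, v x = 0) :
    ∫ x in (0 : ℝ)..1, F x * v x = -∫ x in (0 : ℝ)..1, deriv F x * ∫ t in (0 : ℝ)..x, v t := by
  have hV := hv.absolutelyContinuousOnInterval_intervalIntegral (c := 0) (by simp)
  have h := hF.integral_mul_deriv_eq_deriv_mul hV
  have hae : ∫ x in (0 : ℝ)..1, F x * v x
      = ∫ x in (0 : ℝ)..1, F x * deriv (fun y => ∫ t in (0 : ℝ)..y, v t) x := by
    refine intervalIntegral.integral_congr_ae ?_
    filter_upwards [hv.ae_hasDerivAt_integral] with x hx hx'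
    rw [(hx (Set.uIoc_subset_uIcc hx') 0 (by simp)).deriv]
  rw [hae, h]
  simp [hv0]

theorem norm_integral_ofReal_mul_le {G : ℝ → ℝ} (hG : IntervalIntegrable G volume 0 1) {g : ℝ → ℂ}
    {C : ℝ} (hC : ∀ x, 0 ≤ x → ‖g x‖ ≤ C) :
    ‖∫ x in (0 : ℝ)..1, (G x : ℂ) * g x‖ ≤ C * ∫ x in (0 : ℝ)..1, |G x| := by
  rw [← intervalIntegral.integral_const_mul]
  refine intervalIntegral.norm_integral_le_of_norm_le zero_le_one
    (Filter.Eventually.of_forall fun x hx => ?_) (hG.abs.const_mul C)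
  rw [norm_mul, Complex.norm_real, Real.norm_eq_abs, mul_comm]
  exact mul_le_mul_of_nonneg_right (hC x hx.1.le) (abs_nonneg _)

theorem intervalIntegrable_ofReal_mul {G : ℝ → ℝ} (hG : IntervalIntegrable G volume 0 1)
    {g : ℝ → ℂ} (hg : Measurable g) {C : ℝ} (hC : ∀ x, ‖g x‖ ≤ C) :
    IntervalIntegrable (fun x => (G x : ℂ) * g x) volume 0 1 := by
  rw [intervalIntegrable_iff] at hG ⊢
  exact hG.ofReal.mul_bdd hg.aestronglyMeasurable (Filter.Eventually.of_forall hC)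

theorem integral_ofReal_mul_eq_neg_integral_deriv_mul_primitive {F : ℝ → ℝ} {w : ℝ → ℂ}
    (hF : AbsolutelyContinuousOnInterval F 0 1) (hw : IntervalIntegrable w volume 0 1)
    (hw0 : ∫ x in (0 : ℝ)..1, w x = 0) :
    ∫ x in (0 : ℝ)..1, (F x : ℂ) * w x
      = -∫ x in (0 : ℝ)..1, ((deriv F x : ℝ) : ℂ) * ∫ t in (0 : ℝ)..x, w t := by
  -- Both sides are compared after applying the real and the imaginary part.
  have key : ∀ L : ℂ →L[ℝ] ℝ, L (∫ x in (0 : ℝ)..1, (F x : ℂ) * w x)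
      = L (-∫ x in (0 : ℝ)..1, ((deriv F x : ℝ) : ℂ) * ∫ t in (0 : ℝ)..x, w t) := by
    intro L
    have hsmul : ∀ (a : ℝ) (u : ℂ), L ((a : ℂ) * u) = a * L u := fun a u => by
      rw [← Complex.real_smul, map_smul, smul_eq_mul]
    have hwI : ∀ x ∈ Set.uIcc (0 : ℝ) 1, IntervalIntegrable w volume 0 x := fun x hx =>
      hw.mono_set (Set.uIcc_subset_uIcc_left hx)
    have hLw : IntervalIntegrable (fun x => L (w x)) volume 0 1 :=
      ⟨L.integrable_comp hw.1, L.integrable_comp hw.2⟩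
    have hFw : IntervalIntegrable (fun x => (F x : ℂ) * w x) volume 0 1 :=
      hw.continuousOn_mul (Complex.continuous_ofReal.comp_continuousOn hF.continuousOn)
    have hprim : ContinuousOn (fun x => ∫ t in (0 : ℝ)..x, w t) (Set.uIcc 0 1) :=
      intervalIntegral.continuousOn_primitive_interval' hw (by simp)
    have hF'w : IntervalIntegrable (fun x => ((deriv F x : ℝ) : ℂ) * ∫ t in (0 : ℝ)..x, w t)
        volume 0 1 :=
      IntervalIntegrable.mul_continuousOn
        ⟨hF.intervalIntegrable_deriv.1.ofReal, hF.intervalIntegrable_deriv.2.ofReal⟩ hprim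
    rw [map_neg, ← L.intervalIntegral_comp_comm hFw, ← L.intervalIntegral_comp_comm hF'w]
    simp only [hsmul]
    rw [integral_mul_eq_neg_integral_deriv_mul_primitive hF hLw]
    · congr 1
      refine intervalIntegral.integral_congr fun x hx => ?_
      rw [L.intervalIntegral_comp_comm (hwI x hx)]
    · rw [L.intervalIntegral_comp_comm hw, hw0, map_zero]
  exact Complex.ext (key Complex.reCLM) (key Complex.imCLM)

/-! ### Walsh coefficients of a function and of its derivative -/

section Recursion

variable {b : ℕ}

theorem walshCoeff_eq_neg_integral_mul_primitive (hb : 2 ≤ b) {F G : ℝ → ℝ}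
    (hF : AbsolutelyContinuousOnInterval F 0 1) (hFG : Set.EqOn (deriv F) G (Set.Ioo 0 1))
    {k : ℕ} (hk : k ≠ 0) :
    walshCoeff b F k
      = -∫ x in (0 : ℝ)..1, (G x : ℂ) * ∫ t in (0 : ℝ)..x, conj (wal b k t) := by
  rw [walshCoeff, integral_ofReal_mul_eq_neg_integral_deriv_mul_primitive hF
    (intervalIntegrable_of_bounded (measurable_conj_wal b k) (fun x => (norm_conj_wal hb k x).le)
      0 1) (integral_conj_wal_eq_zero hb hk)]
  congr 1
  refine intervalIntegral.integral_congr_Ioo_of_le zero_le_one fun x hx => ?_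
  simp only [hFG hx]

theorem intervalIntegrable_of_deriv_eqOn {F G : ℝ → ℝ}
    (hF : AbsolutelyContinuousOnInterval F 0 1) (hFG : Set.EqOn (deriv F) G (Set.Ioo 0 1)) :
    IntervalIntegrable G volume 0 1 :=
  hF.intervalIntegrable_deriv.congr_uIoo (by rwa [Set.uIoo_of_le zero_le_one])

theorem one_le_two_mul_inv_two_sin (hb : 2 ≤ b) : 1 ≤ 2 * (2 * Real.sin (Real.pi / b))⁻¹ := by
  have h := sin_pi_div_pos hb
  rw [mul_inv, ← mul_assoc, mul_inv_cancel₀ two_ne_zero, one_mul]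
  exact (one_le_inv₀ h).2 (Real.sin_le_one _)

/-- Integrating by parts once gains the leading position `n + 1` of `k`. -/
theorem norm_walshCoeff_le (hb : 2 ≤ b) {F G : ℝ → ℝ}
    (hF : AbsolutelyContinuousOnInterval F 0 1) (hFG : Set.EqOn (deriv F) G (Set.Ioo 0 1))
    {n κ k' : ℕ} (hκ0 : κ ≠ 0) (hκ : κ < b) (hk' : k' < b ^ n) :
    ‖walshCoeff b F (κ * b ^ n + k')‖
      ≤ 4 * (2 * Real.sin (Real.pi / b))⁻¹ * (∫ x in (0 : ℝ)..1, |G x|) * (b : ℝ)⁻¹ ^ (n + 1) := by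
  have hk : κ * b ^ n + k' ≠ 0 := by
    have : 0 < κ * b ^ n := Nat.mul_pos (Nat.pos_of_ne_zero hκ0) (by positivity)
    omega
  rw [walshCoeff_eq_neg_integral_mul_primitive hb hF hFG hk, norm_neg]
  refine (norm_integral_ofReal_mul_le (intervalIntegrable_of_deriv_eqOn hF hFG)
    (C := (b : ℝ)⁻¹ ^ (n + 1) * (4 * (2 * Real.sin (Real.pi / b))⁻¹)) fun x hx => ?_).trans_eq
      (by ring)
  rw [integral_conj_wal hb hκ0 hκ hk' hx, norm_mul, norm_inv, norm_pow, Complex.norm_natCast,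
    ← inv_pow]
  refine mul_le_mul_of_nonneg_left ?_ (by positivity)
  refine (norm_add_le _ _).trans ?_
  rw [norm_mul, norm_mul, norm_conj_wal hb, one_mul, Complex.norm_real, Real.norm_eq_abs,
    abs_of_nonneg (Int.fract_nonneg _)]
  have h1 : ‖conj (wal b k' x) - conj (wal b (κ * b ^ n + k') x)‖ ≤ 2 := by
    refine (norm_sub_le _ _).trans ?_
    rw [norm_conj_wal hb, norm_conj_wal hb]
    norm_num
  have h2 := norm_inv_one_sub_le hb hκ0 hκ
  have h3 := one_le_two_mul_inv_two_sin hb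
  have h4 := Int.fract_lt_one (x * (b : ℝ) ^ (n + 1))
  have h5 : ‖(1 - rootInv b ^ κ)⁻¹‖ * ‖conj (wal b k' x) - conj (wal b (κ * b ^ n + k') x)‖
      ≤ (2 * Real.sin (Real.pi / b))⁻¹ * 2 :=
    mul_le_mul h2 h1 (norm_nonneg _) ((norm_nonneg _).trans h2)
  linarith

/-- The moments of `G` against the product of `conj wal_k` and the sawtooth function of period
`b⁻ᵐ`. -/
noncomputable def sawCoeff (b : ℕ) (G : ℝ → ℝ) (k m : ℕ) : ℂ :=
  ∫ x in (0 : ℝ)..1,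
    (G x : ℂ) * (conj (wal b k x) * ((Int.fract (x * (b : ℝ) ^ m) - 1 / 2 : ℝ) : ℂ))

theorem measurable_conj_wal_mul_saw (b k m : ℕ) :
    Measurable fun x => conj (wal b k x) * ((Int.fract (x * (b : ℝ) ^ m) - 1 / 2 : ℝ) : ℂ) :=
  (measurable_conj_wal b k).mul (Complex.measurable_ofReal.comp
    ((measurable_fract.comp (measurable_id.mul_const _)).sub_const _))

theorem norm_conj_wal_mul_saw_le (hb : 2 ≤ b) (k m : ℕ) (x : ℝ) :
    ‖conj (wal b k x) * ((Int.fract (x * (b : ℝ) ^ m) - 1 / 2 : ℝ) : ℂ)‖ ≤ 1 := by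
  rw [norm_mul, norm_conj_wal hb, one_mul, Complex.norm_real, Real.norm_eq_abs, abs_le]
  have h1 := Int.fract_nonneg (x * (b : ℝ) ^ m)
  have h2 := Int.fract_lt_one (x * (b : ℝ) ^ m)
  constructor <;> linarith

theorem norm_sawCoeff_le (hb : 2 ≤ b) {G : ℝ → ℝ} (hG : IntervalIntegrable G volume 0 1)
    (k m : ℕ) : ‖sawCoeff b G k m‖ ≤ ∫ x in (0 : ℝ)..1, |G x| :=
  (norm_integral_ofReal_mul_le hG fun x _ => norm_conj_wal_mul_saw_le hb k m x).trans_eq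
    (one_mul _)

theorem intervalIntegrable_mul_conj_wal (hb : 2 ≤ b) {G : ℝ → ℝ}
    (hG : IntervalIntegrable G volume 0 1) (k : ℕ) :
    IntervalIntegrable (fun x => (G x : ℂ) * conj (wal b k x)) volume 0 1 :=
  intervalIntegrable_ofReal_mul hG (measurable_conj_wal b k) fun x => (norm_conj_wal hb k x).le

theorem intervalIntegrable_mul_conj_wal_mul_saw (hb : 2 ≤ b) {G : ℝ → ℝ}
    (hG : IntervalIntegrable G volume 0 1) (k m : ℕ) :
    IntervalIntegrable (fun x => (G x : ℂ) *
      (conj (wal b k x) * ((Int.fract (x * (b : ℝ) ^ m) - 1 / 2 : ℝ) : ℂ))) volume 0 1 :=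
  intervalIntegrable_ofReal_mul hG (measurable_conj_wal_mul_saw b k m)
    (norm_conj_wal_mul_saw_le hb k m)

/-- The Walsh coefficients of `F` in terms of those of its derivative `G`. -/
theorem walshCoeff_eq (hb : 2 ≤ b) {F G : ℝ → ℝ}
    (hF : AbsolutelyContinuousOnInterval F 0 1) (hFG : Set.EqOn (deriv F) G (Set.Ioo 0 1))
    {n κ k' : ℕ} (hκ0 : κ ≠ 0) (hκ : κ < b) (hk' : k' < b ^ n) :
    walshCoeff b F (κ * b ^ n + k') = -(((b : ℂ) ^ (n + 1))⁻¹ *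
      ((1 - rootInv b ^ κ)⁻¹ * walshCoeff b G k'
        + (1 / 2 - (1 - rootInv b ^ κ)⁻¹) * walshCoeff b G (κ * b ^ n + k')
        + sawCoeff b G (κ * b ^ n + k') (n + 1))) := by
  have hG := intervalIntegrable_of_deriv_eqOn hF hFG
  have hk : κ * b ^ n + k' ≠ 0 := by
    have : 0 < κ * b ^ n := Nat.mul_pos (Nat.pos_of_ne_zero hκ0) (by positivity)
    omega
  rw [walshCoeff_eq_neg_integral_mul_primitive hb hF hFG hk, walshCoeff, walshCoeff, sawCoeff,
    ← intervalIntegral.integral_const_mul, ← intervalIntegral.integral_const_mul,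
    ← intervalIntegral.integral_add, ← intervalIntegral.integral_add,
    ← intervalIntegral.integral_const_mul]
  · congr 1
    refine intervalIntegral.integral_congr fun x hx => ?_
    rw [Set.uIcc_of_le zero_le_one] at hx
    rw [integral_conj_wal hb hκ0 hκ hk' hx.1]
    push_cast
    ring
  · exact ((intervalIntegrable_mul_conj_wal hb hG _).const_mul _).add
      ((intervalIntegrable_mul_conj_wal hb hG _).const_mul _)
  · exact intervalIntegrable_mul_conj_wal_mul_saw hb hG _ _
  · exact (intervalIntegrable_mul_conj_wal hb hG _).const_mul _
  · exact (intervalIntegrable_mul_conj_wal hb hG _).const_mul _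

theorem fract_mul_pow (hb : 2 ≤ b) (m : ℕ) {x : ℝ} (hx : 0 ≤ x) :
    Int.fract (x * (b : ℝ) ^ m)
      = (b : ℝ)⁻¹ * (realDigit b x (m + 1) + Int.fract (x * (b : ℝ) ^ (m + 1))) := by
  have hb' : (b : ℝ) ≠ 0 := by exact_mod_cast (by omega : b ≠ 0)
  have hfl : ⌊x * (b : ℝ) ^ m⌋₊ = ⌊x * (b : ℝ) ^ (m + 1)⌋₊ / b := by
    rw [← Nat.floor_div_natCast, pow_succ, ← mul_assoc, mul_div_cancel_right₀ _ hb']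
  have h1 := Nat.div_add_mod ⌊x * (b : ℝ) ^ (m + 1)⌋₊ b
  rw [← hfl] at h1
  have h2 : (b : ℝ) * ⌊x * (b : ℝ) ^ m⌋₊ + realDigit b x (m + 1)
      = ⌊x * (b : ℝ) ^ (m + 1)⌋₊ := by
    rw [realDigit]
    exact_mod_cast h1
  rw [← Int.self_sub_floor, ← Int.self_sub_floor, ← natCast_floor_eq_intCast_floor (by positivity),
    ← natCast_floor_eq_intCast_floor (by positivity), ← h2]
  field_simp
  ring

/-- Peeling off one digit of the sawtooth function. -/
theorem sawCoeff_eq (hb : 2 ≤ b) {G : ℝ → ℝ} (hG : IntervalIntegrable G volume 0 1) {k m : ℕ}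
    (hk : k < b ^ m) :
    sawCoeff b G k m = (b : ℂ)⁻¹ * (∑ j ∈ Finset.Ico 1 b,
      rootInv b ^ j / (1 - rootInv b ^ j) * walshCoeff b G (j * b ^ m + k)
        + sawCoeff b G k (m + 1)) := by
  have hb' : (b : ℂ) ≠ 0 := by exact_mod_cast (by omega : b ≠ 0)
  have hsum : ∑ j ∈ Finset.Ico 1 b,
      rootInv b ^ j / (1 - rootInv b ^ j) * walshCoeff b G (j * b ^ m + k)
      = ∫ x in (0 : ℝ)..1, ∑ j ∈ Finset.Ico 1 b, rootInv b ^ j / (1 - rootInv b ^ j) *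
        ((G x : ℂ) * conj (wal b (j * b ^ m + k) x)) := by
    rw [intervalIntegral.integral_finsetSum fun j _ =>
      (intervalIntegrable_mul_conj_wal hb hG _).const_mul _]
    simp only [intervalIntegral.integral_const_mul, walshCoeff]
  have hint : IntervalIntegrable (fun x => ∑ j ∈ Finset.Ico 1 b,
      rootInv b ^ j / (1 - rootInv b ^ j) *
        ((G x : ℂ) * conj (wal b (j * b ^ m + k) x))) volume 0 1 := by
    have := IntervalIntegrable.sum (Finset.Ico 1 b)
      (f := fun j x => rootInv b ^ j / (1 - rootInv b ^ j) *
        ((G x : ℂ) * conj (wal b (j * b ^ m + k) x))) (μ := volume) (a := 0) (b := 1)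
      fun j _ => (intervalIntegrable_mul_conj_wal hb hG _).const_mul _
    simpa only [Finset.sum_fn] using this
  rw [hsum, sawCoeff, sawCoeff, ← intervalIntegral.integral_add hint
    (intervalIntegrable_mul_conj_wal_mul_saw hb hG _ _), ← intervalIntegral.integral_const_mul]
  refine intervalIntegral.integral_congr fun x hx => ?_
  rw [Set.uIcc_of_le zero_le_one] at hx
  have hd : realDigit b x (m + 1) < b := Nat.mod_lt _ (by omega)
  have hterm : ∑ j ∈ Finset.Ico 1 b, rootInv b ^ j / (1 - rootInv b ^ j) *
        ((G x : ℂ) * conj (wal b (j * b ^ m + k) x))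
      = (G x : ℂ) * conj (wal b k x) * ((realDigit b x (m + 1) : ℂ) - ((b : ℂ) - 1) / 2) := by
    rw [sub_half_eq_sum_rootInv hb hd, Finset.mul_sum]
    refine Finset.sum_congr rfl fun j hj => ?_
    rw [Finset.mem_Ico] at hj
    rw [conj_wal_leading hb (by omega) hj.2 hk]
    ring
  rw [hterm, fract_mul_pow hb m hx.1]
  push_cast
  field_simp
  ring

/-- Solving the recursive inequality that one digit of the sawtooth function yields. -/
theorem le_of_digit_recursion (hb : 2 ≤ b) {t : ℕ → ℝ} {M A : ℝ} (hM : ∀ c, t c ≤ M)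
    (ht : ∀ c, t c ≤ (b : ℝ)⁻¹ * (((b : ℝ) - 1) * A * (b : ℝ)⁻¹ ^ (c + 1) + t (c + 1))) :
    t 0 ≤ A / (b + 1) := by
  have hb2 : (2 : ℝ) ≤ b := by exact_mod_cast hb
  have hb0 : (0 : ℝ) < b := by linarith
  set β := (b : ℝ)⁻¹ with hβ
  have hβ0 : 0 < β := by positivity
  have hβ1 : β < 1 := inv_lt_one_of_one_lt₀ (by linarith)
  have hbβ : (b : ℝ) * β = 1 := mul_inv_cancel₀ hb0.ne'
  -- `u c` is nondecreasing in `c` and its upper bound `M βᶜ` tends to `0`.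
  have hu : ∀ c, t 0 - A / (b + 1) ≤ t c * β ^ c - A / (b + 1) * β ^ (2 * c) := by
    intro c
    induction c with
    | zero => simp
    | succ c ih =>
      refine ih.trans ?_
      have h1 := mul_le_mul_of_nonneg_right (ht c) (pow_nonneg hβ0.le c)
      have h2 : A / (b + 1) * β ^ (2 * c) - A / (b + 1) * β ^ (2 * (c + 1))
          = β * ((b - 1) * A * β ^ (c + 1)) * β ^ c := by
        have e : β ^ (2 * c) = (b : ℝ) ^ 2 * β ^ (2 * c + 2) := by
          calc β ^ (2 * c) = ((b : ℝ) * β) ^ 2 * β ^ (2 * c) := by rw [hbβ]; ring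
            _ = _ := by ring
        rw [e]
        field_simp
        ring
      have h3 : β * ((b - 1) * A * β ^ (c + 1) + t (c + 1)) * β ^ c
          = β * ((b - 1) * A * β ^ (c + 1)) * β ^ c + t (c + 1) * β ^ (c + 1) := by ring
      linarith
  have hlim1 : Filter.Tendsto (fun c : ℕ => β ^ c) Filter.atTop (nhds 0) :=
    tendsto_pow_atTop_nhds_zero_of_lt_one hβ0.le hβ1
  have hlim2 : Filter.Tendsto (fun c : ℕ => β ^ (2 * c)) Filter.atTop (nhds 0) := by
    simp only [pow_mul]
    exact tendsto_pow_atTop_nhds_zero_of_lt_one (by positivity) (by nlinarith)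
  have hlim := (hlim1.const_mul M).sub (hlim2.const_mul (A / (b + 1)))
  have := ge_of_tendsto' hlim (fun c => (hu c).trans
    (sub_le_sub_right (mul_le_mul_of_nonneg_right (hM c) (pow_nonneg hβ0.le c)) _))
  linarith

theorem norm_sawCoeff_le_of_decay (hb : 2 ≤ b) {G : ℝ → ℝ} (hG : IntervalIntegrable G volume 0 1)
    {k m : ℕ} (hk : k < b ^ m) {A : ℝ}
    (hA : ∀ c j, j ≠ 0 → j < b → ‖walshCoeff b G (j * b ^ (m + c) + k)‖ ≤ A * (b : ℝ)⁻¹ ^ (c + 1)) :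
    ‖sawCoeff b G k m‖ ≤ (2 * Real.sin (Real.pi / b))⁻¹ * A / (b + 1) := by
  have hs := sin_pi_div_pos hb
  refine le_of_digit_recursion hb (t := fun c => ‖sawCoeff b G k (m + c)‖)
    (fun c => norm_sawCoeff_le hb hG k _) fun c => ?_
  have hkc : k < b ^ (m + c) := hk.trans_le (Nat.pow_le_pow_right (by omega) (by omega))
  rw [sawCoeff_eq hb hG hkc, norm_mul, norm_inv, Complex.norm_natCast]
  refine mul_le_mul_of_nonneg_left ((norm_add_le _ _).trans ?_) (by positivity)
  refine add_le_add ?_ (le_of_eq (by rw [add_assoc]))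
  refine (norm_sum_le_of_le (f := fun j => rootInv b ^ j / (1 - rootInv b ^ j) *
    walshCoeff b G (j * b ^ (m + c) + k)) (n := fun _ => (2 * Real.sin (Real.pi / b))⁻¹ *
    (A * (b : ℝ)⁻¹ ^ (c + 1))) _ fun j hj => ?_).trans_eq ?_
  · rw [Finset.mem_Ico] at hj
    rw [norm_mul, div_eq_mul_inv, norm_mul, norm_pow, norm_rootInv hb, one_pow, one_mul]
    exact mul_le_mul (norm_inv_one_sub_le hb (by omega) hj.2) (hA c j (by omega) hj.2)
      (norm_nonneg _) (by positivity)
  · rw [Finset.sum_const, Nat.card_Ico, nsmul_eq_mul, Nat.cast_sub (by omega)]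
    push_cast
    ring

theorem norm_walshCoeff_le_of_decay (hb : 2 ≤ b) {F G : ℝ → ℝ}
    (hF : AbsolutelyContinuousOnInterval F 0 1) (hFG : Set.EqOn (deriv F) G (Set.Ioo 0 1))
    {n κ k' : ℕ} (hκ0 : κ ≠ 0) (hκ : κ < b) (hk' : k' < b ^ n) {A₁ A₂ A₃ : ℝ}
    (h₁ : ‖walshCoeff b G k'‖ ≤ A₁) (h₂ : ‖walshCoeff b G (κ * b ^ n + k')‖ ≤ A₂)
    (h₃ : ∀ c j, j ≠ 0 → j < b →
      ‖walshCoeff b G (j * b ^ (n + 1 + c) + (κ * b ^ n + k'))‖ ≤ A₃ * (b : ℝ)⁻¹ ^ (c + 1)) :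
    ‖walshCoeff b F (κ * b ^ n + k')‖ ≤ (2 * Real.sin (Real.pi / b))⁻¹ *
      (A₁ + A₂ + A₃ / (b + 1)) * (b : ℝ)⁻¹ ^ (n + 1) := by
  have hG := intervalIntegrable_of_deriv_eqOn hF hFG
  have hs := sin_pi_div_pos hb
  rw [walshCoeff_eq hb hF hFG hκ0 hκ hk', norm_neg, norm_mul, norm_inv, norm_pow,
    Complex.norm_natCast, ← inv_pow, mul_comm]
  refine mul_le_mul_of_nonneg_right ?_ (by positivity)
  refine (norm_add₃_le).trans ?_
  rw [norm_mul, norm_mul, mul_add, mul_add, ← mul_div_assoc]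
  have hS : 0 ≤ (2 * Real.sin (Real.pi / b))⁻¹ := by positivity
  exact add_le_add (add_le_add
    (mul_le_mul (norm_inv_one_sub_le hb hκ0 hκ) h₁ (norm_nonneg _) hS)
    (mul_le_mul (norm_half_sub_inv_le hb hκ0 hκ) h₂ (norm_nonneg _) hS))
    (norm_sawCoeff_le_of_decay hb hG (leading_lt_pow hκ hk') h₃)

end Recursion

/-! ### Decay of the Walsh coefficients -/

section Decay

variable {b : ℕ}

/-- One step of the induction on the number `i + 1` of derivatives: passing from the derivative `G`
to `F` gains the leading position of `k`, one factor `(2 sin (π/b))⁻¹` and one factor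
`1 + 1/b + 1/(b(b+1))`. -/
theorem norm_walshCoeff_le_perRate_succ (hb : 2 ≤ b) {F G : ℝ → ℝ}
    (hF : AbsolutelyContinuousOnInterval F 0 1) (hFG : Set.EqOn (deriv F) G (Set.Ioo 0 1))
    (hG0 : walshCoeff b G 0 = 0) {i : ℕ} {B : ℝ}
    (hG : ∀ k, k ≠ 0 → ‖walshCoeff b G k‖ ≤ B * (b : ℝ)⁻¹ ^ perRate (i + 1) (posList b k))
    {k : ℕ} (hk : k ≠ 0) :
    ‖walshCoeff b F k‖ ≤ (2 * Real.sin (Real.pi / b))⁻¹ * B *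
      (1 + 1 / (b : ℝ) + 1 / ((b : ℝ) * ((b : ℝ) + 1))) *
        (b : ℝ)⁻¹ ^ perRate (i + 2) (posList b k) := by
  obtain ⟨n, κ, k', hκ0, hκ, hk', rfl⟩ := exists_leading_digit hb hk
  have hb2 : (2 : ℝ) ≤ b := by exact_mod_cast hb
  have hb0 : (0 : ℝ) < b := by linarith
  set β := (b : ℝ)⁻¹ with hβ
  have hβ0 : 0 < β := by positivity
  have hβ1 : β ≤ 1 := inv_le_one_of_one_le₀ (by linarith)
  have hs := sin_pi_div_pos hb
  have hB : 0 ≤ B := by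
    have h := (norm_nonneg _).trans (hG _ hk)
    exact nonneg_of_mul_nonneg_left h (by positivity)
  have hkn := leading_lt_pow hκ hk'
  set k := κ * b ^ n + k' with hkdef
  have hlist : posList b k = (n + 1) :: posList b k' := posList_leading hb hκ0 hκ hk'
  have hchain : ((n + 1) :: posList b k').Pairwise (· > ·) := hlist ▸ sortedGT_posList b k
  -- The integers `j bᵐ + k` that occur in the expansion of the sawtooth function.
  have hbig : ∀ (e : ℕ), (∀ c, e + (c + 1) ≤ perRate (i + 1) ((n + 1 + c + 1) :: posList b k)) →
      ∀ c j, j ≠ 0 → j < b →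
        ‖walshCoeff b G (j * b ^ (n + 1 + c) + k)‖ ≤ B * β ^ e * β ^ (c + 1) := by
    intro e he c j hj0 hjb
    have hlt : k < b ^ (n + 1 + c) := hkn.trans_le (Nat.pow_le_pow_right (by omega) (by omega))
    refine (hG _ (by omega)).trans ?_
    rw [posList_leading hb hj0 hjb hlt, mul_assoc, ← pow_add]
    exact mul_le_mul_of_nonneg_left (pow_le_pow_of_le_one hβ0.le hβ1 (he c)) hB
  by_cases hk0 : k' = 0
  · -- One nonzero digit: the term of `k'` vanishes as `G` has mean zero.
    have hnil : posList b k' = [] := by rw [hk0, posList_zero]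
    have h := norm_walshCoeff_le_of_decay hb hF hFG hκ0 hκ hk' (A₁ := 0)
      (A₂ := B * β ^ ((i + 1) * (n + 1))) (A₃ := B * β ^ ((i + 1) * (n + 1)))
      (by rw [hk0, hG0, norm_zero])
      (by simpa only [hlist, hnil, perRate_singleton] using hG k hk)
      (hbig _ fun c => by
        rw [hlist, hnil, perRate_succ_cons _ _ (List.cons_ne_nil _ _), perRate_singleton]
        apply le_of_eq
        ring)
    refine h.trans ?_
    rw [hlist, hnil, perRate_singleton,
      show (i + 2) * (n + 1) = (i + 1) * (n + 1) + (n + 1) by ring, pow_add]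
    have hD : 1 + 1 / ((b : ℝ) + 1) ≤ 1 + 1 / (b : ℝ) + 1 / ((b : ℝ) * ((b : ℝ) + 1)) := by
      have : 1 / ((b : ℝ) + 1) ≤ 1 / (b : ℝ) := one_div_le_one_div_of_le hb0 (by linarith)
      have : 0 < 1 / ((b : ℝ) * ((b : ℝ) + 1)) := by positivity
      linarith
    have hX : 0 ≤ (2 * Real.sin (Real.pi / b))⁻¹ * B *
        (β ^ ((i + 1) * (n + 1)) * β ^ (n + 1)) := by positivity
    have := mul_le_mul_of_nonneg_left hD hX
    refine le_trans (le_of_eq ?_) (this.trans_eq ?_) <;> ring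
  · have hne : posList b k' ≠ [] := posList_ne_nil hb hk0
    have hlt := perRate_succ_lt_cons i (n + 1) hchain hne
    have h := norm_walshCoeff_le_of_decay hb hF hFG hκ0 hκ hk'
      (A₁ := B * β ^ perRate (i + 1) (posList b k'))
      (A₂ := B * β ^ (perRate (i + 1) (posList b k') + 1))
      (A₃ := B * β ^ (perRate (i + 1) (posList b k') + 1))
      (hG k' hk0)
      ((hG k hk).trans (mul_le_mul_of_nonneg_left (pow_le_pow_of_le_one hβ0.le hβ1
        (by rw [hlist]; omega)) hB))
      (hbig _ fun c => by
        have h1 := perRate_succ_cons i (n + 1) hne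
        have h2 := perRate_le_cons i (n + 1) hchain
        rw [hlist, perRate_succ_cons _ _ (List.cons_ne_nil _ _)]
        omega)
    have hD : 1 + 1 / (b : ℝ) + 1 / ((b : ℝ) * ((b : ℝ) + 1)) = 1 + β + β / (b + 1) := by
      rw [hβ]
      field_simp
    refine h.trans (le_of_eq ?_)
    rw [hD, hlist, perRate_succ_cons _ _ hne]
    ring

theorem absolutelyContinuousOnInterval_derivI {r : ℕ} {f : ℝ → ℝ} (hf : MemSobolev r f) {s : ℕ}
    (hs : s < r) : AbsolutelyContinuousOnInterval (derivI s f) 0 1 := by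
  rcases Nat.lt_or_ge s (r - 1) with h | h
  · have h1 : ContDiffOn ℝ ((s + 1 : ℕ)) f (Set.Icc 0 1) :=
      hf.contDiffOn.of_le (by exact_mod_cast h)
    have h2 := ((contDiffOn_nat_succ_iff_contDiffOn_one_iteratedDerivWithin
      (uniqueDiffOn_Icc zero_lt_one)).1 h1).2
    rw [← Set.uIcc_of_le zero_le_one] at h2
    refine ContDiffOn.absolutelyContinuousOnInterval ?_
    rw [derivI, ← Set.uIcc_of_le zero_le_one]
    exact h2
  · have : s = r - 1 := by omega
    rw [this]
    exact hf.absolutelyContinuous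

theorem deriv_derivI_eqOn (s : ℕ) (f : ℝ → ℝ) :
    Set.EqOn (deriv (derivI s f)) (derivI (s + 1) f) (Set.Ioo 0 1) := by
  intro x hx
  rw [derivI, derivI, iteratedDerivWithin_succ,
    derivWithin_of_mem_nhds (Icc_mem_nhds hx.1 hx.2)]

theorem walshCoeff_zero (b : ℕ) (f : ℝ → ℝ) :
    walshCoeff b f 0 = ((∫ x in (0 : ℝ)..1, f x : ℝ) : ℂ) := by
  simp only [walshCoeff, wal_zero, map_one, mul_one]
  exact intervalIntegral.integral_ofReal

/-- The decay of the Walsh coefficients of the derivative of order `r - i - 1`. -/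
theorem norm_walshCoeff_derivI_le (hb : 2 ≤ b) {r : ℕ} {f : ℝ → ℝ} (hf : MemSobolevPer r f) {i : ℕ}
    (hi : i + 1 ≤ r) {k : ℕ} (hk : k ≠ 0) :
    ‖walshCoeff b (derivI (r - (i + 1)) f) k‖ ≤
      4 * (2 * Real.sin (Real.pi / b))⁻¹ ^ (i + 1) *
        (1 + 1 / (b : ℝ) + 1 / ((b : ℝ) * ((b : ℝ) + 1))) ^ i *
        (∫ x in (0 : ℝ)..1, |derivI r f x|) * (b : ℝ)⁻¹ ^ perRate (i + 1) (posList b k) := by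
  induction i generalizing k with
  | zero =>
    obtain ⟨n, κ, k', hκ0, hκ, hk', rfl⟩ := exists_leading_digit hb hk
    have hFG := deriv_derivI_eqOn (r - 1) f
    rw [Nat.sub_add_cancel hi] at hFG
    have h := norm_walshCoeff_le hb
      (absolutelyContinuousOnInterval_derivI hf.memSobolev (by omega)) hFG hκ0 hκ hk'
    have hrate : perRate (0 + 1) (posList b (κ * b ^ n + k')) = n + 1 := by
      rw [posList_leading hb hκ0 hκ hk']
      cases posList b k' <;> simp [perRate]
    rw [hrate]
    simpa using h
  | succ i ih =>
    have hFG := deriv_derivI_eqOn (r - (i + 1 + 1)) f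
    rw [show r - (i + 1 + 1) + 1 = r - (i + 1) by omega] at hFG
    have hG0 : walshCoeff b (derivI (r - (i + 1)) f) 0 = 0 := by
      rw [walshCoeff_zero, hf.integral_eq_zero _ (by omega), Complex.ofReal_zero]
    refine (norm_walshCoeff_le_perRate_succ hb
      (absolutelyContinuousOnInterval_derivI hf.memSobolev (by omega)) hFG hG0
      (fun k hk => ih (by omega) hk) hk).trans_eq ?_
    rw [show i + 1 + 1 = i + 2 by rfl]
    ring

end Decay

end WalshDecay

theorem mainTheorem5 (b : ℕ) (hb : 2 ≤ b) (r : ℕ) (hr : 1 < r) :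
    (∀ f : ℝ → ℝ, WalshDecay.MemSobolevPer r f → ∀ k : ℕ,
      ‖WalshDecay.walshCoeff b f k‖ ≤
        (∫ x in (0 : ℝ)..1, |WalshDecay.derivI r f x|) *
          (2 * (b : ℝ) ^ (-(WalshDecay.muPer b r k : ℤ)) / (2 * Real.sin (Real.pi / b)) ^ r *
            (1 + 1 / (b : ℝ) + 1 / ((b : ℝ) * ((b : ℝ) + 1))) ^ (r - 2) *
            (7 / 2 + 2 / (b : ℝ) + (2 * (b : ℝ) + 1) / ((b : ℝ) - 1)))) ∧
    ∀ k : ℕ, WalshDecay.mu b r k ≤ WalshDecay.muPer b r k ∧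
      (WalshDecay.mu b r k < WalshDecay.muPer b r k ↔
        1 ≤ WalshDecay.numDigits b k ∧ WalshDecay.numDigits b k < r) := by
  refine ⟨fun f hf k => ?_, WalshDecay.mu_le_muPer hb r⟩
  have hb2 : (2 : ℝ) ≤ b := by exact_mod_cast hb
  have hb0 : (0 : ℝ) < b := by linarith
  have hs := WalshDecay.sin_pi_div_pos hb
  have hN : 0 ≤ ∫ x in (0 : ℝ)..1, |WalshDecay.derivI r f x| :=
    intervalIntegral.integral_nonneg zero_le_one fun x _ => abs_nonneg _
  have hq : (b : ℝ) ^ (-(WalshDecay.muPer b r k : ℤ)) = (b : ℝ)⁻¹ ^ WalshDecay.muPer b r k := by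
    rw [zpow_neg, zpow_natCast, inv_pow]
  have hC : 7 / 2 ≤ 7 / 2 + 2 / (b : ℝ) + (2 * (b : ℝ) + 1) / ((b : ℝ) - 1) := by
    have h1 : 0 < 2 / (b : ℝ) := by positivity
    have h2 : 0 < (2 * (b : ℝ) + 1) / ((b : ℝ) - 1) := div_pos (by linarith) (by linarith)
    linarith
  by_cases hk : k = 0
  · have h0 : WalshDecay.derivI 0 f = f := iteratedDerivWithin_zero
    have h1 := hf.integral_eq_zero 0 (by omega)
    rw [h0] at h1
    rw [hk, WalshDecay.walshCoeff_zero, h1, Complex.ofReal_zero, norm_zero]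
    positivity
  · obtain ⟨i, rfl⟩ : ∃ i, r = i + 2 := ⟨r - 2, by omega⟩
    have h := WalshDecay.norm_walshCoeff_derivI_le hb hf (i := i + 1) le_rfl hk
    have h0 : WalshDecay.derivI (i + 2 - (i + 1 + 1)) f = f := by
      rw [show i + 2 - (i + 1 + 1) = 0 by omega]
      exact iteratedDerivWithin_zero
    rw [h0] at h
    rw [hq, WalshDecay.muPer_eq_perRate, Nat.add_sub_cancel]
    set D := 1 + 1 / (b : ℝ) + 1 / ((b : ℝ) * ((b : ℝ) + 1)) with hD
    -- The induction has produced `4 D` where the claim has `2 (7/2 + ⋯)`, and `D ≤ 1 + 1/2 + 1/6`.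
    have hD2 : 4 * D ≤ 2 * (7 / 2) := by
      have h1 : 1 / (b : ℝ) ≤ 1 / 2 := one_div_le_one_div_of_le two_pos hb2
      have h2 : 1 / ((b : ℝ) * ((b : ℝ) + 1)) ≤ 1 / 6 :=
        one_div_le_one_div_of_le (by norm_num) (by nlinarith)
      linarith
    have hX : 0 ≤ (∫ x in (0 : ℝ)..1, |WalshDecay.derivI (i + 2) f x|) *
        (b : ℝ)⁻¹ ^ WalshDecay.perRate (i + 2) (WalshDecay.posList b k) *
        (2 * Real.sin (Real.pi / b))⁻¹ ^ (i + 2) * D ^ i := by positivity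
    have hfin := mul_le_mul_of_nonneg_left (hD2.trans (mul_le_mul_of_nonneg_left hC zero_le_two)) hX
    refine h.trans (le_trans (le_of_eq ?_) (hfin.trans_eq ?_))
    · ring
    · rw [div_eq_mul_inv _ ((2 * Real.sin (Real.pi / b)) ^ (i + 2)), ← inv_pow]
      ring
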